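/- All graphs are finite, simple and undirected. For a graph $G=(V,E)$, let $\gamma(G)$ be the minimum cardinality of a dominating set of $G$ (a set $S\subseteq V$ such that every vertex is in $S$ or adjacent to an element of $S$), let $\mathrm{core}(G)$ be the set of vertices that belong to every dominating set of cardinality $\gamma(G)$, and put $$V^+=\{v\in V:\gamma(G-v)>\gamma(G)\},\qquad V^0=\{v\in V:\gamma(G-v)=\gamma(G)\}.$$ Let $P_6$ be the path on six vertices, $K_{1,3}$ the claw, and let the bull be the graph with vertices $u_1,u_2,u_3,v_1,v_2$ and edges $u_1u_2,u_2u_3,u_1u_3,u_1v_1,u_2v_2$. (i) Let $H$ be (isomorphic to) an induced subgraph of $P_6$ or of the bull, and let $G$ be a connected graph with at least two vertices that has no induced subgraph isomorphic to $H$ and no induced subgraph isomorphic to $K_{1,3}$. Then every $v\in\mathrm{core}(G)$ lies in $V^+$. (ii) There is a connected graph $G$ with no induced subgraph isomorphic to $K_{1,3}$, which contains both the bull and $P_6$ as induced subgraphs, and which has a vertex in $\mathrm{core}(G)\cap V^0$. -/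

import Mathlib

namespace SimpleGraph

universe u

variable {V : Type u}

/-- Every vertex is in `S` or adjacent to an element of `S`. -/
def IsDominatingSet (G : SimpleGraph V) (S : Finset V) : Prop :=
  ∀ v, v ∈ S ∨ ∃ u ∈ S, G.Adj u v

/-- The domination number `γ(G)`: the least cardinality of a dominating set
(it is used only for finite graphs, where the whole vertex set is dominating). -/
noncomputable def dominationNumber (G : SimpleGraph V) : ℕ :=
  sInf {k | ∃ S : Finset V, G.IsDominatingSet S ∧ S.card = k}

/-- A minimum dominating set. -/
def IsMinDominatingSet (G : SimpleGraph V) (S : Finset V) : Prop :=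
  G.IsDominatingSet S ∧ S.card = G.dominationNumber

/-- The set of vertices belonging to all minimum dominating sets. -/
def domCore (G : SimpleGraph V) : Set V :=
  {v | ∀ S : Finset V, G.IsMinDominatingSet S → v ∈ S}

/-- The graph `G - v`, induced by the vertices other than `v`. -/
def deleteVertex (G : SimpleGraph V) (v : V) : SimpleGraph ↥({v}ᶜ : Set V) :=
  G.induce ({v}ᶜ : Set V)

/-- `V⁺`: the vertices `v` with `γ(G - v) > γ(G)`. -/
def vPlus (G : SimpleGraph V) : Set V :=
  {v | G.dominationNumber < (G.deleteVertex v).dominationNumber}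

/-- `V⁰`: the vertices `v` with `γ(G - v) = γ(G)`. -/
def vZero (G : SimpleGraph V) : Set V :=
  {v | (G.deleteVertex v).dominationNumber = G.dominationNumber}

/-- The claw `K₁,₃`. -/
def claw : SimpleGraph (Fin 1 ⊕ Fin 3) :=
  completeBipartiteGraph (Fin 1) (Fin 3)

/-- The bull: the triangle `0, 1, 2` with a pendant vertex `3` at `0` and a pendant vertex `4`
at `1`. -/
def bull : SimpleGraph (Fin 5) :=
  fromEdgeSet {s(0, 1), s(1, 2), s(0, 2), s(0, 3), s(1, 4)}

end SimpleGraph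

/-! For (i), forbidding an induced subgraph of `P₆` or of the bull forbids `P₆` or the bull itself,
so only these two cases matter. If `v` is in the core but not in `V⁺`, exchange arguments give a
`CoreConfig`: a minimum dominating set `D` with nonadjacent private neighbours `x`, `y` of `v`, and
an independent dominating set `D'` of `G - v` of size at most `γ(G)` that misses the neighbours of
`v`.

`P₆`-free: neighbours `a`, `b` of `x`, `y` in `D'` have a common dominator `d` in `D`. Exchanging
`v, d` for `x, b`, for `y, a`, and then for the two vertices so obtained leaves a vertex whose
forced adjacencies are contradictory.

Bull-free: if `v` separates `x` from `y`, mixing `D` on one side with `D'` on the other forces `|D'|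
< |D|`, which is impossible. Otherwise a shortest `x`–`y` path in `G - v` closes up through `v` to
an induced cycle of length at least six. Every vertex then sees exactly three consecutive vertices
of that cycle, so `D` can be projected to the cycle and rotated, and the core is empty.

For (ii), an explicit graph on eight vertices is checked. -/

namespace SimpleGraph

universe u

variable {V : Type u}

/-! ### Forbidden induced subgraphs as adjacency rules -/

section ForbiddenSubgraphs

variable {G : SimpleGraph V}

theorem adj_of_claw_free (hG : ¬ claw.IsIndContained G) {c x y z : V} (hx : G.Adj c x)
    (hy : G.Adj c y) (hz : G.Adj c z) (hxy : x ≠ y) (hxz : x ≠ z) (hyz : y ≠ z)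
    (nxy : ¬ G.Adj x y) (nxz : ¬ G.Adj x z) : G.Adj y z := by
  by_contra nyz
  have key : ∀ i j, G.Adj (Sum.elim (fun _ => c) ![x, y, z] i)
      (Sum.elim (fun _ => c) ![x, y, z] j) ↔ claw.Adj i j := by
    have := mt Adj.symm nxy
    have := mt Adj.symm nxz
    have := mt Adj.symm nyz
    rintro (i | i) (j | j)
    · simp [claw]
    · fin_cases j <;> simp [claw, hx, hy, hz]
    · fin_cases i <;> simp [claw, hx.symm, hy.symm, hz.symm]
    · fin_cases i <;> fin_cases j <;> simp [claw, *]
  refine hG ⟨⟨⟨Sum.elim (fun _ => c) ![x, y, z], ?_⟩, key _ _⟩⟩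
  have := hx.ne
  have := hy.ne
  have := hz.ne
  rintro (i | i) (j | j) h
  · rw [Subsingleton.elim i j]
  · fin_cases j <;> simp_all
  · fin_cases i <;> simp_all
  · fin_cases i <;> fin_cases j <;> simp_all

/-- A bull-free graph has no triangle `a, b, c` with pendant vertices `p` at `a` and `q` at `b`. -/
theorem bull_free_elim (hG : ¬ bull.IsIndContained G) {a b c p q : V} (hab : G.Adj a b)
    (hbc : G.Adj b c) (hac : G.Adj a c) (hap : G.Adj a p) (hbq : G.Adj b q)
    (naq : ¬ G.Adj a q) (nbp : ¬ G.Adj b p) (ncp : ¬ G.Adj c p) (ncq : ¬ G.Adj c q)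
    (npq : ¬ G.Adj p q) : False := by
  have e1 : c ≠ p := by rintro rfl; exact nbp hbc
  have e2 : c ≠ q := by rintro rfl; exact naq hac
  have e3 : p ≠ q := by rintro rfl; exact naq hap
  have e4 : a ≠ q := by rintro rfl; exact npq hap.symm
  have e5 : b ≠ p := by rintro rfl; exact npq hbq
  have := hab.ne
  have := hbc.ne
  have := hac.ne
  have := hap.ne
  have := hbq.ne
  have key : ∀ i j, G.Adj (![a, b, c, p, q] i) (![a, b, c, p, q] j) ↔ bull.Adj i j := by
    intro i j
    have := hab.symm
    have := hbc.symm
    have := hac.symm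
    have := hap.symm
    have := hbq.symm
    have := mt Adj.symm naq
    have := mt Adj.symm nbp
    have := mt Adj.symm ncp
    have := mt Adj.symm ncq
    have := mt Adj.symm npq
    fin_cases i <;> fin_cases j <;> simp [bull, *]
  refine hG ⟨⟨⟨![a, b, c, p, q], ?_⟩, key _ _⟩⟩
  intro i j h
  fin_cases i <;> fin_cases j <;> simp_all

theorem path_free_elim (hG : ¬ (pathGraph 6).IsIndContained G) {a b c d e f : V}
    (hab : G.Adj a b) (hbc : G.Adj b c) (hcd : G.Adj c d) (hde : G.Adj d e) (hef : G.Adj e f)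
    (nac : ¬ G.Adj a c) (nad : ¬ G.Adj a d) (nae : ¬ G.Adj a e) (naf : ¬ G.Adj a f)
    (nbd : ¬ G.Adj b d) (nbe : ¬ G.Adj b e) (nbf : ¬ G.Adj b f)
    (nce : ¬ G.Adj c e) (ncf : ¬ G.Adj c f) (ndf : ¬ G.Adj d f) : False := by
  have key : ∀ i j : Fin 6, G.Adj (![a, b, c, d, e, f] i) (![a, b, c, d, e, f] j) ↔
      (pathGraph 6).Adj i j := by
    intro i j
    have := hab.symm
    have := hbc.symm
    have := hcd.symm
    have := hde.symm
    have := hef.symm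
    have := mt Adj.symm nac
    have := mt Adj.symm nad
    have := mt Adj.symm nae
    have := mt Adj.symm naf
    have := mt Adj.symm nbd
    have := mt Adj.symm nbe
    have := mt Adj.symm nbf
    have := mt Adj.symm nce
    have := mt Adj.symm ncf
    have := mt Adj.symm ndf
    fin_cases i <;> fin_cases j <;> simp [pathGraph_adj, *]
  refine hG ⟨⟨⟨![a, b, c, d, e, f], ?_⟩, key _ _⟩⟩
  intro i j h
  -- Distinctness comes for free: equal images have equal neighbourhoods, and no two vertices of
  -- `P₆` do.
  have h1 : ∀ k, (pathGraph 6).Adj i k ↔ (pathGraph 6).Adj j k := fun k => by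
    rw [← key, ← key, h]
  have h2 : ∀ i j : Fin 6, (∀ k : Fin 6, (i.val + 1 = k.val ∨ k.val + 1 = i.val) ↔
      (j.val + 1 = k.val ∨ k.val + 1 = j.val)) → i = j := by decide
  exact h2 i j (by simpa [pathGraph_adj] using h1)

end ForbiddenSubgraphs

/-! ### Exchanges in minimum dominating sets -/

section Domination

variable {G : SimpleGraph V}

theorem IsDominatingSet.dominationNumber_le {S : Finset V} (hS : G.IsDominatingSet S) :
    G.dominationNumber ≤ S.card :=
  Nat.sInf_le ⟨S, hS, rfl⟩

theorem exists_isMinDominatingSet [Finite V] (G : SimpleGraph V) :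
    ∃ S, G.IsMinDominatingSet S := by
  have := Fintype.ofFinite V
  exact Nat.sInf_mem (s := {k | ∃ S : Finset V, G.IsDominatingSet S ∧ S.card = k})
    ⟨_, Finset.univ, fun v => Or.inl (Finset.mem_univ v), rfl⟩

theorem dominationNumber_lt_card_of_mem_domCore {v : V} (hv : v ∈ G.domCore) {S : Finset V}
    (hS : G.IsDominatingSet S) (hvS : v ∉ S) : G.dominationNumber < S.card :=
  lt_of_le_of_ne hS.dominationNumber_le fun h => hvS (hv S ⟨hS, h.symm⟩)

/-- Exchanging `R ∋ v` for a set `A ∌ v` that is no larger leaves some vertex undominated, if `v`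
is in all minimum dominating sets. -/
theorem exists_undominated_of_exchange [DecidableEq V] {v : V} (hv : v ∈ G.domCore)
    {D R A : Finset V} (hD : G.IsMinDominatingSet D) (hR : R ⊆ D) (hvR : v ∈ R) (hvA : v ∉ A)
    (hcard : A.card ≤ R.card) :
    ∃ z, z ∉ A ∧ (∀ u ∈ A, ¬ G.Adj u z) ∧ (∀ u ∈ D, u ∉ R → u ≠ z ∧ ¬ G.Adj u z) ∧
      (z ∈ R ∨ ∃ u ∈ R, G.Adj u z) := by
  have h1 : ¬ G.IsDominatingSet ((D \ R) ∪ A) := by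
    intro h
    have h2 := dominationNumber_lt_card_of_mem_domCore hv h (by simp [hvR, hvA])
    have h3 := Finset.card_union_le (D \ R) A
    have h4 := Finset.card_sdiff_add_card_eq_card hR
    have h5 := hD.2
    omega
  simp only [IsDominatingSet, not_forall, not_or, not_exists, not_and, Finset.mem_union,
    Finset.mem_sdiff] at h1
  obtain ⟨z, ⟨hz1, hz2⟩, hz3⟩ := h1
  refine ⟨z, hz2, fun u hu => hz3 u (Or.inr hu), fun u hu hR => ⟨?_, hz3 u (Or.inl ⟨hu, hR⟩)⟩, ?_⟩
  · rintro rfl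
    exact hz1 hu hR
  · rcases hD.1 z with h | ⟨u, hu, h⟩
    · exact Or.inl (not_not.1 (hz1 h))
    · by_cases hR : u ∈ R
      · exact Or.inr ⟨u, hR, h⟩
      · exact absurd h (hz3 u (Or.inl ⟨hu, hR⟩))

/-- `x` is a neighbour of `v` that is dominated by no other element of `D`. -/
def IsPrivateNeighbor (G : SimpleGraph V) (D : Finset V) (v x : V) : Prop :=
  G.Adj v x ∧ ∀ h ∈ D, h ≠ v → h ≠ x ∧ ¬ G.Adj h x

/-- Exchange `v` for `w`: the vertex left undominated is not `v`, which `w` dominates. Applying this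
again with `w` a private neighbour yields two nonadjacent ones. -/
theorem exists_isPrivateNeighbor_not_adj {v : V} (hv : v ∈ G.domCore) {D : Finset V}
    (hD : G.IsMinDominatingSet D) {w : V} (hw : G.Adj v w) :
    ∃ x, G.IsPrivateNeighbor D v x ∧ x ≠ w ∧ ¬ G.Adj w x := by
  classical
  obtain ⟨z, h1, h2, h3, h4⟩ := exists_undominated_of_exchange hv (R := {v}) (A := {w}) hD
    (by simpa using hv D hD) (by simp) (by simpa using hw.ne) (by simp)
  simp only [Finset.mem_singleton, forall_eq, exists_eq_left] at h1 h2 h3 h4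
  rcases h4 with rfl | h4
  · exact absurd hw.symm h2
  · exact ⟨z, ⟨h4, h3⟩, h1, h2⟩

/-- The vertex `v` lies in all minimum dominating sets; `D` is a minimum dominating set, `D'` is an
independent dominating set of `G - v` which is no larger and avoids the neighbours of `v`, and
`x`, `y` are nonadjacent private neighbours of `v` with respect to `D`. -/
structure CoreConfig (G : SimpleGraph V) (v : V) (D D' : Finset V) (x y : V) : Prop where
  mem_core : v ∈ G.domCore
  min : G.IsMinDominatingSet D
  card_le : D'.card ≤ G.dominationNumber
  not_mem : v ∉ D'
  not_adj : ∀ u ∈ D', ¬ G.Adj v u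
  indep : ∀ u ∈ D', ∀ w ∈ D', ¬ G.Adj u w
  dom : ∀ u, u ≠ v → u ∈ D' ∨ ∃ w ∈ D', G.Adj w u
  priv_left : G.IsPrivateNeighbor D v x
  priv_right : G.IsPrivateNeighbor D v y
  ne : x ≠ y
  not_adj_priv : ¬ G.Adj x y

/-- A minimum dominating set of a claw-free graph can be chosen independent. -/
theorem exists_independent_isMinDominatingSet [Finite V] (hG : ¬ claw.IsIndContained G) :
    ∃ S, G.IsMinDominatingSet S ∧ ∀ u ∈ S, ∀ w ∈ S, ¬ G.Adj u w := by
  classical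
  have := Fintype.ofFinite V
  -- Minimise the number of internal adjacencies. If `u`, `w` in `S` are adjacent, replacing `u` by
  -- a private neighbour `z` removes the edge `uw` and adds none, so the result cannot dominate. It
  -- misses a private neighbour `t` of `u` not adjacent to `z`, and `u; w, z, t` is a claw.
  let e : Finset V → ℕ := fun S => ((S ×ˢ S).filter fun p => G.Adj p.1 p.2).card
  obtain ⟨S, hS, hmin⟩ := Set.exists_min_image {S | G.IsMinDominatingSet S} e
    (Set.toFinite _) (exists_isMinDominatingSet G)
  refine ⟨S, hS, fun u hu w hw huw => ?_⟩
  have hlt : ∀ z, G.Adj u z → (∀ t ∈ S, t ≠ u → t ≠ z ∧ ¬ G.Adj t z) →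
      ¬ G.IsDominatingSet (insert z (S.erase u)) := by
    intro z huz hz hdom
    have hzS : z ∉ S.erase u := fun h => (hz z (Finset.mem_of_mem_erase h)
      (Finset.ne_of_mem_erase h)).1 rfl
    have hc : (insert z (S.erase u)).card = S.card := by
      rw [Finset.card_insert_of_notMem hzS, Finset.card_erase_add_one hu]
    have h1 := hmin _ (show G.IsMinDominatingSet _ from ⟨hdom, hc.trans hS.2⟩)
    refine absurd h1 (not_le.2 (Finset.card_lt_card (Finset.ssubset_iff_of_subset ?_ |>.2
      ⟨(u, w), ?_, ?_⟩)))
    · rintro ⟨s, t⟩ h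
      simp only [Finset.mem_filter, Finset.mem_product, Finset.mem_insert, Finset.mem_erase] at h ⊢
      obtain ⟨⟨hs | hs, ht | ht⟩, hst⟩ := h
      · subst hs ht; exact absurd hst (G.loopless.irrefl _)
      · subst hs; exact absurd hst.symm (hz t ht.2 ht.1).2
      · subst ht; exact absurd hst (hz s hs.2 hs.1).2
      · exact ⟨⟨hs.2, ht.2⟩, hst⟩
    · simp [hu, hw, huw]
    · simp [huz.ne]
  have h1 : ¬ G.IsDominatingSet (S.erase u) := by
    intro h
    have h2 := h.dominationNumber_le
    have h3 := Finset.card_erase_lt_of_mem hu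
    have h4 := hS.2
    omega
  have priv : ∀ A : Finset V, ¬ G.IsDominatingSet (A ∪ S.erase u) → ∃ z, G.Adj u z ∧
      (∀ t ∈ S, t ≠ u → t ≠ z ∧ ¬ G.Adj t z) ∧ ∀ a ∈ A, a ≠ z ∧ ¬ G.Adj a z := by
    intro A hA
    simp only [IsDominatingSet, not_forall, not_or, not_exists, not_and, Finset.mem_union,
      Finset.mem_erase] at hA
    obtain ⟨z, ⟨hz1, hz2⟩, hz3⟩ := hA
    have hzu : z ≠ u := by
      rintro rfl
      exact hz3 w (Or.inr ⟨huw.ne', hw⟩) huw.symm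
    refine ⟨z, ?_, fun t ht htu => ⟨?_, hz3 t (Or.inr ⟨htu, ht⟩)⟩, fun a ha =>
      ⟨?_, hz3 a (Or.inl ha)⟩⟩
    · rcases hS.1 z with h | ⟨t, ht, h⟩
      · exact absurd h (hz2 hzu)
      · by_cases htu : t = u
        · exact htu ▸ h
        · exact absurd h (hz3 t (Or.inr ⟨htu, ht⟩))
    · rintro rfl; exact hz2 htu ht
    · rintro rfl; exact hz1 ha
  obtain ⟨z, huz, hz, -⟩ := priv ∅ (by simpa using h1)
  obtain ⟨t, hut, ht, htz⟩ := priv {z} (Finset.insert_eq z _ ▸ hlt z huz hz)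
  have htz := htz z (Finset.mem_singleton_self z)
  have hwz := hz w hw huw.ne'
  have hwt := ht w hw huw.ne'
  exact htz.2 (adj_of_claw_free hG huw huz hut hwz.1 hwt.1 htz.1 hwz.2 hwt.2)

/-- `D'` is an independent minimum dominating set of `G - v`. A neighbour of `v` in it would make it
dominate `G` with at most `γ(G)` vertices and without `v`. -/
theorem exists_coreConfig [Finite V] (hclaw : ¬ claw.IsIndContained G) {v w : V}
    (hvw : G.Adj v w) (hv : v ∈ G.domCore) (hv' : v ∉ G.vPlus) :
    ∃ D D' x y, CoreConfig G v D D' x y := by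
  classical
  obtain ⟨D, hD⟩ := exists_isMinDominatingSet G
  obtain ⟨x, hx, -⟩ := exists_isPrivateNeighbor_not_adj hv hD hvw
  obtain ⟨y, hy, hyx, hxy⟩ := exists_isPrivateNeighbor_not_adj hv hD hx.1
  have hc : ¬ claw.IsIndContained (G.deleteVertex v) := fun h =>
    hclaw (h.trans ⟨Embedding.induce _⟩)
  obtain ⟨T, hT, hTi⟩ := exists_independent_isMinDominatingSet hc
  have hcard : T.card ≤ G.dominationNumber := hT.2 ▸ not_lt.1 hv'
  have hmem : ∀ u, u ∈ T.map (Function.Embedding.subtype _) ↔ ∃ h : u ≠ v, ⟨u, h⟩ ∈ T := by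
    intro u
    simp
  have hdom : ∀ u, u ≠ v → u ∈ T.map (Function.Embedding.subtype _) ∨
      ∃ w ∈ T.map (Function.Embedding.subtype _), G.Adj w u := by
    intro u hu
    rcases hT.1 ⟨u, hu⟩ with h | ⟨t, ht, h⟩
    · exact Or.inl ((hmem u).2 ⟨hu, h⟩)
    · exact Or.inr ⟨t, (hmem t).2 ⟨t.2, ht⟩, h⟩
  have hvT : v ∉ T.map (Function.Embedding.subtype _) := by
    intro h
    obtain ⟨h, -⟩ := (hmem v).1 h
    exact h rfl
  refine ⟨D, T.map (Function.Embedding.subtype _), x, y, hv, hD, by simpa using hcard, hvT,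
    ?_, ?_, hdom, hx, hy, hyx.symm, hxy⟩
  · intro u hu huv
    have h1 : G.IsDominatingSet (T.map (Function.Embedding.subtype _)) := by
      intro z
      by_cases hz : z = v
      · exact Or.inr ⟨u, hu, hz ▸ huv.symm⟩
      · exact hdom z hz
    have h2 := dominationNumber_lt_card_of_mem_domCore hv h1 hvT
    rw [Finset.card_map] at h2
    omega
  · intro u hu w hw huw
    obtain ⟨hu', hu⟩ := (hmem u).1 hu
    obtain ⟨hw', hw⟩ := (hmem w).1 hw
    exact hTi _ hu _ hw huw

end Domination

/-! ### Local structure of a core configuration -/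

namespace CoreConfig

variable {G : SimpleGraph V} {v x y : V} {D D' : Finset V}

theorem symm (c : CoreConfig G v D D' x y) : CoreConfig G v D D' y x :=
  { c with
    priv_left := c.priv_right
    priv_right := c.priv_left
    ne := c.ne.symm
    not_adj_priv := mt Adj.symm c.not_adj_priv }

theorem mem (c : CoreConfig G v D D' x y) : v ∈ D := c.mem_core D c.min

/-- Otherwise `v; h, x, y` is a claw, as `x` and `y` are private. -/
theorem not_adj_of_mem (c : CoreConfig G v D D' x y) (hclaw : ¬ claw.IsIndContained G)
    {h : V} (hh : h ∈ D) (hv : h ≠ v) : ¬ G.Adj v h := by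
  intro hvh
  obtain ⟨hx, nx⟩ := c.priv_left.2 h hh hv
  obtain ⟨hy, ny⟩ := c.priv_right.2 h hh hv
  exact c.not_adj_priv (adj_of_claw_free hclaw hvh c.priv_left.1 c.priv_right.1 hx hy c.ne nx ny)

/-- A neighbour of a private neighbour `t` of `v`, if not adjacent to `v`, is dominated by an
element of `D` other than `v`. -/
theorem exists_dominator (c : CoreConfig G v D D' x y) {t u : V}
    (ht : G.IsPrivateNeighbor D v t) (htu : G.Adj t u) (huv : u ≠ v) (nvu : ¬ G.Adj v u) :
    u ∉ D ∧ ∃ h ∈ D, h ≠ v ∧ G.Adj h u := by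
  have huD : u ∉ D := fun h => (ht.2 u h huv).2 htu.symm
  refine ⟨huD, ?_⟩
  rcases c.min.1 u with h | ⟨h, hh, hu⟩
  · exact absurd h huD
  · refine ⟨h, hh, ?_, hu⟩
    rintro rfl
    exact nvu hu

/-- The private neighbours of `v` adjacent to a given vertex outside the closed neighbourhood of
`v` form a clique. -/
theorem adj_of_common_neighbor (c : CoreConfig G v D D' x y) (hclaw : ¬ claw.IsIndContained G)
    {s t u : V} (hs : G.IsPrivateNeighbor D v s) (ht : G.IsPrivateNeighbor D v t) (hst : s ≠ t)
    (hsu : G.Adj s u) (htu : G.Adj t u) (huv : u ≠ v) (nvu : ¬ G.Adj v u) : G.Adj s t := by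
  obtain ⟨-, h, hh, hv, hu⟩ := c.exists_dominator hs hsu huv nvu
  -- The dominator `h` of `u` sees neither `s` nor `t`, so the claw at `u` forces `s` and `t`
  -- together.
  exact adj_of_claw_free hclaw hu.symm hsu.symm htu.symm (hs.2 h hh hv).1 (ht.2 h hh hv).1 hst
    (hs.2 h hh hv).2 (ht.2 h hh hv).2

theorem exists_neighbor (c : CoreConfig G v D D' x y) {t : V} (ht : G.IsPrivateNeighbor D v t) :
    ∃ a ∈ D', G.Adj t a ∧ a ≠ v ∧ ¬ G.Adj v a := by
  rcases c.dom t ht.1.ne' with h | ⟨a, ha, hat⟩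
  · exact absurd ht.1 (c.not_adj t h)
  · exact ⟨a, ha, hat.symm, fun h => c.not_mem (h ▸ ha), c.not_adj a ha⟩

/-! ### The case without induced `P₆` -/

section PathFree

/-- The vertex left undominated when `v`, `d` are exchanged for `x`, `b`. -/
theorem exists_common_neighbor (c : CoreConfig G v D D' x y) (hclaw : ¬ claw.IsIndContained G)
    (hpath : ¬ (pathGraph 6).IsIndContained G) {a b d : V} (ha : a ∈ D') (hb : b ∈ D')
    (hxa : G.Adj x a) (hyb : G.Adj y b) (hd : d ∈ D) (hda : G.Adj d a) (hdb : G.Adj d b)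
    (hdv : d ≠ v) :
    ∃ z, G.Adj v z ∧ G.Adj d z ∧ G.Adj y z ∧ G.Adj a z ∧ ¬ G.Adj x z ∧ ¬ G.Adj b z := by
  classical
  have hav : a ≠ v := fun h => c.not_mem (h ▸ ha)
  have hbv : b ≠ v := fun h => c.not_mem (h ▸ hb)
  have nva := c.not_adj a ha
  have nvb := c.not_adj b hb
  have nab := c.indep a ha b hb
  have nya : ¬ G.Adj y a := fun h =>
    c.not_adj_priv (c.adj_of_common_neighbor hclaw c.priv_left c.priv_right c.ne hxa h hav nva)
  have nxb : ¬ G.Adj x b := fun h =>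
    c.not_adj_priv (c.adj_of_common_neighbor hclaw c.priv_left c.priv_right c.ne h hyb hbv nvb)
  have hab : a ≠ b := by rintro rfl; exact nya hyb
  have nvd := c.not_adj_of_mem hclaw hd hdv
  obtain ⟨hdx, ndx⟩ := c.priv_left.2 d hd hdv
  obtain ⟨hdy, ndy⟩ := c.priv_right.2 d hd hdv
  have hvx := c.priv_left.1
  have hvy := c.priv_right.1
  have nxy := c.not_adj_priv
  obtain ⟨z, hz1, hz2, hz3, hz4⟩ := exists_undominated_of_exchange c.mem_core (R := {v, d})
    (A := {x, b}) c.min (by simp [Finset.insert_subset_iff, c.mem, hd]) (by simp)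
    (by simp [hvx.ne, hbv.symm]) (by
      rw [Finset.card_pair hdv.symm]; exact Finset.card_le_two)
  simp only [Finset.mem_insert, Finset.mem_singleton, not_or, forall_eq_or_imp, forall_eq,
    exists_eq_or_imp, exists_eq_left] at hz1 hz2 hz3 hz4
  obtain ⟨hzx, hzb⟩ : z ≠ x ∧ z ≠ b := hz1
  obtain ⟨nxz, nbz⟩ := hz2
  have hzv : z ≠ v := by rintro rfl; exact nxz hvx.symm
  have hzd : z ≠ d := by rintro rfl; exact nbz hdb.symm
  have hzy : z ≠ y := by rintro rfl; exact nbz hyb.symm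
  have hza : z ≠ a := by rintro rfl; exact nxz hxa
  have hz4 : G.Adj v z ∨ G.Adj d z := by tauto
  have hdz' : G.Adj d z → G.Adj a z := fun hdz =>
    adj_of_claw_free hclaw hdb hda hdz hab.symm hzb.symm hza.symm (mt Adj.symm nab) nbz
  have hvz' : G.Adj v z → G.Adj y z := fun hvz =>
    adj_of_claw_free hclaw hvx hvy hvz c.ne hzx.symm hzy.symm nxy nxz
  -- `z` must see both `v` and `d`. If only `v`, it is a private neighbour, and a neighbour `e` of
  -- it in `D'` gives a claw at `d` or the path `d a x v z e`. If only `d`, the path `z a x v y b`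
  -- is induced.
  by_cases hvz : G.Adj v z
  · by_cases hdz : G.Adj d z
    · exact ⟨z, hvz, hdz, hvz' hvz, hdz' hdz, nxz, nbz⟩
    · exfalso
      have hz : G.IsPrivateNeighbor D v z := by
        refine ⟨hvz, fun h hh hv => ?_⟩
        by_cases hhd : h = d
        · subst hhd
          exact ⟨hzd.symm, hdz⟩
        · exact hz3 h hh ⟨hv, hhd⟩
      obtain ⟨e, he, hze, hev, nve⟩ := c.exists_neighbor hz
      have nxe : ¬ G.Adj x e := fun h =>
        nxz (c.adj_of_common_neighbor hclaw c.priv_left hz hzx.symm h hze hev nve)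
      have naz : ¬ G.Adj a z := fun h =>
        nxz (c.adj_of_common_neighbor hclaw c.priv_left hz hzx.symm hxa h.symm hav nva)
      have hae : a ≠ e := by rintro rfl; exact nxe hxa
      have hbe : b ≠ e := by rintro rfl; exact nbz hze.symm
      by_cases hde : G.Adj d e
      · exact c.indep b hb e he (adj_of_claw_free hclaw hda hdb hde hab hae hbe nab
          (c.indep a ha e he))
      · exact path_free_elim hpath hda hxa.symm hvx.symm hvz hze ndx (mt Adj.symm nvd) hdz hde
          (mt Adj.symm nva) naz (c.indep a ha e he) nxz nxe nve
  · exfalso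
    have hdz := hz4.resolve_left hvz
    have haz := hdz' hdz
    have nyz : ¬ G.Adj y z := fun hyz => nbz
      (adj_of_claw_free hclaw hvy.symm hyb hyz hbv.symm hzv.symm hzb.symm nvb hvz)
    exact path_free_elim hpath haz.symm hxa.symm hvx.symm hvy hyb (mt Adj.symm nxz)
      (mt Adj.symm hvz) (mt Adj.symm nyz) (mt Adj.symm nbz) (mt Adj.symm nva) (mt Adj.symm nya)
      nab nxy nxb nvb

theorem false_of_path_free (c : CoreConfig G v D D' x y) (hclaw : ¬ claw.IsIndContained G)
    (hpath : ¬ (pathGraph 6).IsIndContained G) : False := by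
  classical
  obtain ⟨a, ha, hxa, hav, nva⟩ := c.exists_neighbor c.priv_left
  obtain ⟨b, hb, hyb, hbv, nvb⟩ := c.exists_neighbor c.priv_right
  have nab := c.indep a ha b hb
  have nya : ¬ G.Adj y a := fun h =>
    c.not_adj_priv (c.adj_of_common_neighbor hclaw c.priv_left c.priv_right c.ne hxa h hav nva)
  have nxb : ¬ G.Adj x b := fun h =>
    c.not_adj_priv (c.adj_of_common_neighbor hclaw c.priv_left c.priv_right c.ne h hyb hbv nvb)
  have hab : a ≠ b := by rintro rfl; exact nya hyb
  obtain ⟨haD, d, hd, hdv, hda⟩ := c.exists_dominator c.priv_left hxa hav nva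
  have nvd := c.not_adj_of_mem hclaw hd hdv
  obtain ⟨hdx, ndx⟩ := c.priv_left.2 d hd hdv
  obtain ⟨hdy, ndy⟩ := c.priv_right.2 d hd hdv
  have hvx := c.priv_left.1
  have hvy := c.priv_right.1
  have nxy := c.not_adj_priv
  -- All other adjacencies in `d a x v y b` are those of an induced path.
  have hdb : G.Adj d b := by
    by_contra ndb
    exact path_free_elim hpath hda hxa.symm hvx.symm hvy hyb ndx (mt Adj.symm nvd) ndy ndb
      (mt Adj.symm nva) (mt Adj.symm nya) nab nxy nxb nvb
  obtain ⟨z, hvz, hdz, hyz, haz, nxz, nbz⟩ :=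
    c.exists_common_neighbor hclaw hpath ha hb hxa hyb hd hda hdb hdv
  obtain ⟨z', hvz', hdz', hxz', hbz', nyz', naz'⟩ :=
    c.symm.exists_common_neighbor hclaw hpath hb ha hyb hxa hd hdb hda hdv
  obtain ⟨w, hw1, hw2, hw3, hw4⟩ := exists_undominated_of_exchange c.mem_core (R := {v, d})
    (A := {z, z'}) c.min (by simp [Finset.insert_subset_iff, c.mem, hd]) (by simp)
    (by simp [hvz.ne, hvz'.ne]) (by
      rw [Finset.card_pair hdv.symm]; exact Finset.card_le_two)
  simp only [Finset.mem_insert, Finset.mem_singleton, not_or, forall_eq_or_imp, forall_eq,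
    exists_eq_or_imp, exists_eq_left] at hw1 hw2 hw4
  obtain ⟨hwz, hwz'⟩ : w ≠ z ∧ w ≠ z' := hw1
  obtain ⟨nzw, nzw'⟩ := hw2
  have hwv : w ≠ v := by rintro rfl; exact nzw hvz.symm
  have hwd : w ≠ d := by rintro rfl; exact nzw hdz.symm
  have hwa : w ≠ a := by rintro rfl; exact nzw haz.symm
  have hwb : w ≠ b := by rintro rfl; exact nzw' hbz'.symm
  have hwx : w ≠ x := by rintro rfl; exact nzw' hxz'.symm
  have hwy : w ≠ y := by rintro rfl; exact nzw hyz.symm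
  have hzx : z ≠ x := by rintro rfl; exact ndx hdz
  have hzy' : z' ≠ y := by rintro rfl; exact ndy hdz'
  have hzb : z ≠ b := by rintro rfl; exact nvb hvz
  have hza' : z' ≠ a := by rintro rfl; exact nva hvz'
  -- In either case claws force `w` to see `a`, `b`, `x` and `y`. If `w` also sees `v`, there is a
  -- claw `w; v, a, b`; otherwise `w` is a forbidden common neighbour of `x` and `y`.
  by_cases hvw : G.Adj v w
  · have hxw := adj_of_claw_free hclaw hvz hvx hvw hzx hwz.symm hwx.symm (mt Adj.symm nxz) nzw
    have hyw := adj_of_claw_free hclaw hvz' hvy hvw hzy' hwz'.symm hwy.symm (mt Adj.symm nyz') nzw'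
    have hbw := adj_of_claw_free hclaw hyz hyb hyw hzb hwz.symm hwb.symm (mt Adj.symm nbz) nzw
    have haw := adj_of_claw_free hclaw hxz' hxa hxw hza' hwz'.symm hwa.symm (mt Adj.symm naz') nzw'
    exact nab (adj_of_claw_free hclaw hvw.symm haw.symm hbw.symm hav.symm hbv.symm hab nva nvb)
  · have hdw : G.Adj d w := by tauto
    have hbw := adj_of_claw_free hclaw hdz hdb hdw hzb hwz.symm hwb.symm (mt Adj.symm nbz) nzw
    have haw := adj_of_claw_free hclaw hdz' hda hdw hza' hwz'.symm hwa.symm (mt Adj.symm naz') nzw'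
    have hxw := adj_of_claw_free hclaw haz hxa.symm haw hzx hwz.symm hwx.symm (mt Adj.symm nxz) nzw
    have hyw := adj_of_claw_free hclaw hbz' hyb.symm hbw hzy' hwz'.symm hwy.symm
      (mt Adj.symm nyz') nzw'
    exact nxy (c.adj_of_common_neighbor hclaw c.priv_left c.priv_right c.ne hxw hyw hwv hvw)

end PathFree

/-! ### Private neighbours in the bull-free case -/

section BullFree

/-- If `a` and `b` were adjacent, the claw at `a` would make a dominator `h` of `a` adjacent to `b`,
and the triangle `a, b, h` with pendants `s`, `t` would be a bull. -/
theorem not_adj_of_bull_free (c : CoreConfig G v D D' x y) (hclaw : ¬ claw.IsIndContained G)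
    (hbull : ¬ bull.IsIndContained G) {s t a b : V} (hs : G.IsPrivateNeighbor D v s)
    (ht : G.IsPrivateNeighbor D v t) (hst : s ≠ t) (nst : ¬ G.Adj s t)
    (hsa : G.Adj s a) (hav : a ≠ v) (nva : ¬ G.Adj v a)
    (htb : G.Adj t b) (hbv : b ≠ v) (nvb : ¬ G.Adj v b) : ¬ G.Adj a b := by
  intro hab
  have nta : ¬ G.Adj t a := fun h =>
    nst (c.adj_of_common_neighbor hclaw hs ht hst hsa h hav nva)
  have nsb : ¬ G.Adj s b := fun h =>
    nst (c.adj_of_common_neighbor hclaw hs ht hst h htb hbv nvb)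
  obtain ⟨-, h, hh, hhv, hha⟩ := c.exists_dominator hs hsa hav nva
  obtain ⟨hhs, nhs⟩ := hs.2 h hh hhv
  obtain ⟨hht, nht⟩ := ht.2 h hh hhv
  have hsb : s ≠ b := by rintro rfl; exact nst htb.symm
  have hhb : h ≠ b := by rintro rfl; exact nht htb.symm
  have hhb' := adj_of_claw_free hclaw hsa.symm hha.symm hab hhs.symm hsb hhb (mt Adj.symm nhs) nsb
  exact bull_free_elim hbull hab hhb'.symm hha.symm hsa.symm htb.symm (mt Adj.symm nta)
    (mt Adj.symm nsb) nhs nht nst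

/-- In a bull-free graph, adjacency is transitive on private neighbours of `v`. -/
theorem adj_trans_of_bull_free (c : CoreConfig G v D D' x y) (hclaw : ¬ claw.IsIndContained G)
    (hbull : ¬ bull.IsIndContained G) {s t u : V} (hs : G.IsPrivateNeighbor D v s)
    (ht : G.IsPrivateNeighbor D v t) (hu : G.IsPrivateNeighbor D v u) (hst : s ≠ t)
    (hsu : G.Adj s u) (hut : G.Adj u t) : G.Adj s t := by
  by_contra nst
  obtain ⟨e, he, hue, hev, nve⟩ := c.exists_neighbor hu
  wlog hse : G.Adj s e generalizing s t
  -- The claw `u; s, t, e` is excluded, so `e` sees `s` or `t`.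
  · refine this ht hs hst.symm hut.symm hsu.symm (mt Adj.symm nst) ?_
    refine adj_of_claw_free hclaw hsu.symm hut hue hst ?_ ?_ nst hse
    · rintro rfl; exact nve hs.1
    · rintro rfl; exact nve ht.1
  obtain ⟨b, hb, htb, hbv, nvb⟩ := c.exists_neighbor ht
  have neb := c.not_adj_of_bull_free hclaw hbull hs ht hst nst hse hev nve htb hbv nvb
  have nte : ¬ G.Adj t e := fun h =>
    nst (c.adj_of_common_neighbor hclaw hs ht hst hse h hev nve)
  have heb : e ≠ b := by rintro rfl; exact nte htb
  -- Either a claw `u; v, e, b`, or the triangle `u, t, v` with pendants `e`, `b`.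
  by_cases hub : G.Adj u b
  · exact neb (adj_of_claw_free hclaw hu.1.symm hue hub hev.symm hbv.symm heb nve nvb)
  · exact bull_free_elim hbull hut ht.1.symm hu.1.symm hue htb hub nte nve nvb neb

end BullFree

end CoreConfig

/-! ### Shortest walks -/

section InducedPath

variable {G : SimpleGraph V}

/-- A shortest walk is an induced path. -/
theorem Reachable.exists_induced_path {x y : V} (h : G.Reachable x y) :
    ∃ (m : ℕ) (q : ℕ → V), q 0 = x ∧ q m = y ∧ (∀ i < m, G.Adj (q i) (q (i + 1))) ∧
      ∀ i j, i + 1 < j → j ≤ m → ¬ G.Adj (q i) (q j) ∧ q i ≠ q j := by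
  obtain ⟨W, hW⟩ := h.exists_walk_length_eq_dist
  refine ⟨W.length, W.getVert, W.getVert_zero, W.getVert_length,
    fun i hi => W.adj_getVert_succ hi, fun i j hij hj => ⟨fun hadj => ?_, fun heq => ?_⟩⟩
  · have h1 := dist_le ((W.take i).append (Walk.cons hadj (W.drop j)))
    simp only [Walk.length_append, Walk.length_cons, Walk.take_length, Walk.drop_length] at h1
    omega
  · have h1 := dist_le ((W.take i).append ((W.drop j).copy heq.symm rfl))
    simp only [Walk.length_append, Walk.length_copy, Walk.take_length, Walk.drop_length] at h1
    omega

end InducedPath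

/-! ### Long induced cycles -/

section InducedCycle

variable {G : SimpleGraph V} {n : ℕ}

theorem natCast_zmod_ne_zero {n k : ℕ} (hk : 0 < k) (hkn : k < n) : (k : ZMod n) ≠ 0 := by
  rw [Ne, ZMod.natCast_eq_zero_iff]
  exact fun h => absurd (Nat.le_of_dvd hk h) (by omega)

theorem zmod_ne_zero_of_six_le {o : ZMod n} (ho : o = 1) (hn : 6 ≤ n) :
    o ≠ 0 ∧ 2 * o ≠ 0 ∧ 3 * o ≠ 0 ∧ 4 * o ≠ 0 ∧ 5 * o ≠ 0 := by
  subst ho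
  simp only [mul_one]
  refine ⟨?_, ?_, ?_, ?_, ?_⟩
  · exact_mod_cast natCast_zmod_ne_zero (k := 1) (by omega) (by omega)
  · exact_mod_cast natCast_zmod_ne_zero (k := 2) (by omega) (by omega)
  · exact_mod_cast natCast_zmod_ne_zero (k := 3) (by omega) (by omega)
  · exact_mod_cast natCast_zmod_ne_zero (k := 4) (by omega) (by omega)
  · exact_mod_cast natCast_zmod_ne_zero (k := 5) (by omega) (by omega)

/-- A predicate on `ZMod n` that holds somewhere but not everywhere starts to hold somewhere. -/
theorem exists_zmod_start [NeZero n] {b : ZMod n → Prop} {i k : ZMod n} (hi : b i) (hk : ¬ b k) :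
    ∃ j, b j ∧ ¬ b (j - 1) := by
  by_contra! h
  have h1 : ∀ t : ℕ, b (i - t) := by
    intro t
    induction t with
    | zero => simpa using hi
    | succ t ih =>
      have := h _ ih
      rwa [sub_sub, ← Nat.cast_succ] at this
  have h2 := h1 (i - k).val
  rw [ZMod.natCast_zmod_val, sub_sub_cancel] at h2
  exact hk h2

/- The unit step `o = 1` along a cycle is a variable, so that `grind` treats it as an atom. -/
variable {p : ZMod n → V} {o : ZMod n}

/-- Equal images have the same cycle neighbours, and `{i - 1, i + 1}` determines `i` because `4 ≠ 0`
in `ZMod n`. -/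
theorem injective_of_inducedCycle (ho : o = 1) (hn : 6 ≤ n)
    (hp : ∀ i j, G.Adj (p i) (p j) ↔ j = i + o ∨ i = j + o) : Function.Injective p := by
  intro i j hij
  obtain ⟨e1, e2, e3, e4, e5⟩ := zmod_ne_zero_of_six_le ho hn
  have h1 : G.Adj (p j) (p (i + o)) := by rw [← hij, hp]; exact Or.inl rfl
  have h2 : G.Adj (p j) (p (i - o)) := by rw [← hij, hp]; right; ring
  rw [hp] at h1 h2
  grind

/-- A vertex outside an induced cycle of length at least six but adjacent to it has exactly three
neighbours there, and they are consecutive. -/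
theorem exists_center_of_adj_inducedCycle [NeZero n] (hclaw : ¬ claw.IsIndContained G)
    (hbull : ¬ bull.IsIndContained G) (ho : o = 1) (hn : 6 ≤ n)
    (hp : ∀ i j, G.Adj (p i) (p j) ↔ j = i + o ∨ i = j + o) {w : V} (hw : ∀ j, w ≠ p j)
    {i : ZMod n} (hi : G.Adj w (p i)) :
    ∃ c, ∀ j, G.Adj w (p j) ↔ j = c - o ∨ j = c ∨ j = c + o := by
  obtain ⟨e1, e2, e3, e4, e5⟩ := zmod_ne_zero_of_six_le ho hn
  have inj := injective_of_inducedCycle ho hn hp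
  have hclaw_p : ∀ j, G.Adj w (p j) → ¬ G.Adj w (p (j - o)) → G.Adj w (p (j + o)) := by
    intro j hj hj'
    refine (adj_of_claw_free hclaw (c := p j) (x := p (j - o)) (y := p (j + o)) (z := w)
      ?_ ?_ hj.symm ?_ (hw _).symm (hw _).symm ?_ (mt Adj.symm hj')).symm
    · rw [hp]; right; ring
    · rw [hp]; left; ring
    · intro h; have := inj h; grind
    · rw [hp]; grind
  have hclaw_p' : ∀ j, G.Adj w (p j) → ¬ G.Adj w (p (j + o)) → G.Adj w (p (j - o)) := by
    intro j hj hj'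
    by_contra h
    exact hj' (hclaw_p j hj h)
  have hnot : ∃ k, ¬ G.Adj w (p k) := by
    by_contra! h
    have := adj_of_claw_free hclaw (h 0) (h (2 * o)) (h (4 * o)) (fun h => by have := inj h; grind)
      (fun h => by have := inj h; grind) (fun h => by have := inj h; grind)
      (by rw [hp]; grind) (by rw [hp]; grind)
    rw [hp] at this
    grind
  obtain ⟨k, hk⟩ := hnot
  obtain ⟨j, hj, hj'⟩ := exists_zmod_start (b := fun j => G.Adj w (p j)) hi hk
  rw [← ho] at hj'
  have hj1 := hclaw_p j hj hj'
  -- `j` starts a run of neighbours. Any other `k` gives the triangle `w, p j, p (j + 1)` with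
  -- pendants `p k`, `p (j - 1)`; the index `j - 2` escapes because `p (j - 2)` sees `p (j - 1)`,
  -- and is excluded in `hjm`.
  have hbull_p : ∀ k, G.Adj w (p k) → k = j - 2 * o ∨ k = j ∨ k = j + o ∨ k = j + 2 * o := by
    intro k hk
    by_contra! hne
    obtain ⟨n1, n2, n3, n4⟩ := hne
    have n5 : k ≠ j - o := by rintro rfl; exact hj' hk
    refine bull_free_elim hbull (a := w) (b := p j) (c := p (j + o)) (p := p k) (q := p (j - o))
      hj ?_ hj1 hk ?_ hj' ?_ ?_ ?_ ?_ <;> rw [hp] <;> grind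
  have hj2 : G.Adj w (p (j + 2 * o)) := by
    by_contra h2
    refine bull_free_elim hbull (a := p j) (b := p (j + o)) (c := w) (p := p (j - o))
      (q := p (j + 2 * o)) ?_ hj1.symm hj.symm ?_ ?_ ?_ ?_ hj' h2 ?_ <;> rw [hp] <;> grind
  have hjm : ¬ G.Adj w (p (j - 2 * o)) := by
    intro h
    have h3 := hclaw_p' _ h (by rwa [show j - 2 * o + o = j - o by ring])
    have := hbull_p _ h3
    grind
  refine ⟨j + o, fun k => ⟨fun hk => ?_, ?_⟩⟩
  · rcases hbull_p k hk with rfl | h | h | h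
    · exact absurd hk hjm
    · left; rw [h]; ring
    · right; left; exact h
    · right; right; rw [h]; ring
  · rintro (rfl | rfl | rfl)
    · rwa [add_sub_cancel_right]
    · exact hj1
    · rwa [show j + o + o = j + 2 * o by ring]

/-- The cycle dominates `G`: if `w` off the cycle sees it with centre `c` and a neighbour `u` of `w`
does not, then `w; p (c - 1), p (c + 1), u` is a claw. Closed neighbourhoods let cycle vertices be
their own centres. -/
theorem exists_center_inducedCycle [NeZero n] (hconn : G.Connected)
    (hclaw : ¬ claw.IsIndContained G) (hbull : ¬ bull.IsIndContained G) (ho : o = 1) (hn : 6 ≤ n)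
    (hp : ∀ i j, G.Adj (p i) (p j) ↔ j = i + o ∨ i = j + o) (w : V) :
    ∃ c, ∀ j, (w = p j ∨ G.Adj w (p j)) ↔ j = c - o ∨ j = c ∨ j = c + o := by
  obtain ⟨e1, e2, e3, e4, e5⟩ := zmod_ne_zero_of_six_le ho hn
  have inj := injective_of_inducedCycle ho hn hp
  have near : ∀ w, (∃ j, w = p j ∨ G.Adj w (p j)) →
      ∃ c, ∀ j, (w = p j ∨ G.Adj w (p j)) ↔ j = c - o ∨ j = c ∨ j = c + o := by
    rintro w ⟨j, hj⟩
    by_cases hw : ∃ i, w = p i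
    · obtain ⟨i, rfl⟩ := hw
      refine ⟨i, fun j => ?_⟩
      rw [hp, inj.eq_iff]
      grind
    · push Not at hw
      obtain ⟨c, hc⟩ := exists_center_of_adj_inducedCycle hclaw hbull ho hn hp hw
        (hj.resolve_left (hw j))
      exact ⟨c, fun j => by rw [← hc, or_iff_right (hw j)]⟩
  refine near w ?_
  have step : ∀ w u, G.Adj w u → (∃ j, w = p j ∨ G.Adj w (p j)) →
      ∃ j, u = p j ∨ G.Adj u (p j) := by
    intro w u hwu hw
    by_cases hw' : ∃ i, w = p i
    · obtain ⟨i, rfl⟩ := hw'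
      exact ⟨i, Or.inr hwu.symm⟩
    · push Not at hw'
      obtain ⟨c, hc⟩ := near w hw
      have h1 := ((hc (c - o)).2 (Or.inl rfl)).resolve_left (hw' _)
      have h2 := ((hc (c + o)).2 (Or.inr (Or.inr rfl))).resolve_left (hw' _)
      by_contra! hu
      refine mt Adj.symm (hu (c + o)).2 (adj_of_claw_free hclaw h1 h2 hwu ?_ (hu _).1.symm
        (hu _).1.symm ?_ (mt Adj.symm (hu _).2))
      · intro h; have := inj h; grind
      · rw [hp]; grind
  obtain ⟨W⟩ := hconn.preconnected (p 0) w
  have : ∀ {a b : V} (W : G.Walk a b), (∃ j, a = p j ∨ G.Adj a (p j)) →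
      ∃ j, b = p j ∨ G.Adj b (p j) := by
    intro a b W
    induction W with
    | nil => exact id
    | cons h _ ih => exact fun ha => ih (step _ _ h ha)
  exact this W ⟨0, Or.inl rfl⟩

/-- A connected graph with forbidden claw and bull that has an induced cycle of length at least
six has empty core. -/
theorem notMem_domCore_of_inducedCycle [Finite V] [NeZero n] (hconn : G.Connected)
    (hclaw : ¬ claw.IsIndContained G) (hbull : ¬ bull.IsIndContained G) (ho : o = 1) (hn : 6 ≤ n)
    (hp : ∀ i j, G.Adj (p i) (p j) ↔ j = i + o ∨ i = j + o) (v : V) : v ∉ G.domCore := by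
  classical
  intro hv
  obtain ⟨e1, e2, e3, e4, e5⟩ := zmod_ne_zero_of_six_le ho hn
  have inj := injective_of_inducedCycle ho hn hp
  choose c hc using exists_center_inducedCycle hconn hclaw hbull ho hn hp
  obtain ⟨D, hD⟩ := exists_isMinDominatingSet G
  -- Nearness depends only on the difference of indices: `u` is near `p (c w - r)` exactly when `w`
  -- is near `p (c u + r)`.
  have hdom : ∀ r : ZMod n, G.IsDominatingSet (D.image fun u => p (c u + r)) := by
    intro r w
    have h1 : ∃ u ∈ D, u = p (c w - r) ∨ G.Adj u (p (c w - r)) := by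
      rcases hD.1 (p (c w - r)) with h | ⟨u, hu, h⟩
      · exact ⟨_, h, Or.inl rfl⟩
      · exact ⟨u, hu, Or.inr h⟩
    obtain ⟨u, hu, h⟩ := h1
    rw [hc] at h
    have h2 : w = p (c u + r) ∨ G.Adj w (p (c u + r)) := by
      rw [hc]
      grind
    rcases h2 with h2 | h2
    · left
      rw [h2]
      exact Finset.mem_image_of_mem (fun u => p (c u + r)) hu
    · exact Or.inr ⟨_, Finset.mem_image_of_mem (fun u => p (c u + r)) hu, h2.symm⟩
  have hall : ∀ r, v ∈ D.image fun u => p (c u + r) := by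
    intro r
    by_contra h
    have h1 := dominationNumber_lt_card_of_mem_domCore hv (hdom r) h
    have h2 := Finset.card_image_le (s := D) (f := fun u => p (c u + r))
    have h3 := hD.2
    omega
  obtain ⟨u, hu, rfl⟩ := Finset.mem_image.1 (hall 0)
  -- Now `v` is a cycle vertex lying in every rotated projection; the rotation by `c u - i` yields
  -- an element of `D` with centre `i`.
  have hsurj : D.image c = Finset.univ := by
    refine Finset.eq_univ_iff_forall.2 fun i => ?_
    obtain ⟨t, ht, h⟩ := Finset.mem_image.1 (hall (c u - i))
    have h := inj h
    refine Finset.mem_image.2 ⟨t, ht, ?_⟩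
    linear_combination h
  have hcard : n ≤ D.card := by
    have h1 := Finset.card_image_le (s := D) (f := c)
    rwa [hsurj, Finset.card_univ, ZMod.card] at h1
  -- The cycle minus one vertex still dominates, so `γ(G) ≤ n - 1`, against `n ≤ |D|`.
  have hS : G.IsDominatingSet ((Finset.univ.erase (c u)).image p) := by
    intro w
    obtain ⟨j, hj, hju⟩ : ∃ j, (w = p j ∨ G.Adj w (p j)) ∧ j ≠ c u := by
      by_cases h : c w = c u
      · exact ⟨c w + o, (hc _ _).2 (Or.inr (Or.inr rfl)), by grind⟩
      · exact ⟨c w, (hc _ _).2 (Or.inr (Or.inl rfl)), h⟩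
    have hm : p j ∈ (Finset.univ.erase (c u)).image p :=
      Finset.mem_image_of_mem p (by simp [hju])
    rcases hj with rfl | hj
    · exact Or.inl hm
    · exact Or.inr ⟨_, hm, hj.symm⟩
  have h1 := hS.dominationNumber_le
  rw [Finset.card_image_of_injective _ inj, Finset.card_erase_of_mem (Finset.mem_univ _),
    Finset.card_univ, ZMod.card] at h1
  have h2 := hD.2
  omega

/-- An induced path `q 0, …, q m` and a vertex `v` adjacent exactly to its two ends form an induced
cycle. -/
theorem exists_inducedCycle_of_inducedPath {m : ℕ} {q : ℕ → V} {v : V} (hm : 2 ≤ m)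
    (hq : ∀ i < m, G.Adj (q i) (q (i + 1)))
    (hq' : ∀ i j, i + 1 < j → j ≤ m → ¬ G.Adj (q i) (q j))
    (hv0 : G.Adj v (q 0)) (hvm : G.Adj v (q m)) (hv : ∀ i, 0 < i → i < m → ¬ G.Adj v (q i)) :
    ∃ p : ZMod (m + 2) → V, ∀ i j, G.Adj (p i) (p j) ↔ j = i + 1 ∨ i = j + 1 := by
  -- `r` lists `v, q 0, …, q m`, so the closing edge joins the indices `0` and `m + 1`.
  let r : ℕ → V := fun k => k.casesOn v q
  have hr : ∀ a b, a < b → b ≤ m + 1 → (G.Adj (r a) (r b) ↔ b = a + 1 ∨ (a = 0 ∧ b = m + 1)) := by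
    intro a b hab hb
    obtain ⟨b, rfl⟩ : ∃ t, b = t + 1 := ⟨b - 1, by omega⟩
    rcases a with _ | a
    · change G.Adj v (q b) ↔ _
      rcases Nat.eq_zero_or_pos b with rfl | hb0
      · simp [hv0]
      · by_cases hbm : b = m
        · subst hbm
          simp [hvm]
        · have := hv b hb0 (by omega)
          simp only [this, false_iff]
          omega
    · change G.Adj (q a) (q b) ↔ _
      by_cases h : b = a + 1
      · subst h
        simp [hq a (by omega)]
      · have := hq' a b (by omega) (by omega)
        simp only [this, false_iff]
        omega
  have hsucc : ∀ i j : ZMod (m + 2), j = i + 1 ↔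
      j.val = i.val + 1 ∨ (i.val = m + 1 ∧ j.val = 0) := by
    intro i j
    have hi := ZMod.val_lt i
    have hj := ZMod.val_lt j
    have h1 : (1 : ZMod (m + 2)).val = 1 := ZMod.val_one'' (by omega)
    rw [← (ZMod.val_injective (m + 2)).eq_iff, ZMod.val_add, h1]
    by_cases h : i.val + 1 < m + 2
    · rw [Nat.mod_eq_of_lt h]
      omega
    · have h2 : i.val + 1 = m + 2 := by omega
      rw [h2, Nat.mod_self]
      omega
  refine ⟨fun i => r i.val, fun i j => ?_⟩
  have hi := ZMod.val_lt i
  have hj := ZMod.val_lt j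
  rw [hsucc, hsucc]
  rcases lt_trichotomy i.val j.val with h | h | h
  · rw [hr _ _ h (by omega)]
    omega
  · simp only [h, SimpleGraph.irrefl, false_iff]
    omega
  · rw [G.adj_comm, hr _ _ h (by omega)]
    omega

end InducedCycle

/-! ### Conclusion of the bull-free case -/

namespace CoreConfig

variable {G : SimpleGraph V} {v x y : V} {D D' : Finset V}

/-- Adding `x` to `D'` gives a dominating set without `v`, hence one with more than `γ(G)` elements.
-/
theorem dominationNumber_le_card (c : CoreConfig G v D D' x y) :
    G.dominationNumber ≤ D'.card := by
  classical
  have hx := c.priv_left.1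
  have h1 : G.IsDominatingSet (insert x D') := by
    intro u
    by_cases hu : u = v
    · exact Or.inr ⟨x, by simp, hu ▸ hx.symm⟩
    · rcases c.dom u hu with h | ⟨w, hw, h⟩
      · exact Or.inl (by simp [h])
      · exact Or.inr ⟨w, by simp [hw], h⟩
  have h2 := dominationNumber_lt_card_of_mem_domCore c.mem_core h1
    (by simp [hx.ne, c.not_mem])
  have h3 := Finset.card_insert_le x D'
  omega

/-- If `v` separates `A` from the rest of the graph and its neighbours in `A` are dominated by one
of them, then `D` has at least as many elements in `A` as `D'`. -/
theorem card_filter_le_of_separated [DecidableEq V] (c : CoreConfig G v D D' x y) {A : V → Prop}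
    [DecidablePred A] (hvA : ¬ A v) (hsep : ∀ s t, G.Adj s t → t ≠ v → A s → A t)
    {w : V} (hvw : G.Adj v w) (hw : ∀ u, A u → G.Adj v u → u = w ∨ G.Adj w u) :
    (D'.filter A).card ≤ (D.filter A).card := by
  by_contra! hlt
  -- Take `D` inside `A`, `D'` outside, and `w` for `v` and its neighbours in `A`: by `hlt` this has
  -- at most `|D'|` elements, yet it avoids `v`.
  have hS : G.IsDominatingSet (insert w (D.filter A ∪ D'.filter fun u => ¬ A u)) := by
    intro u
    by_cases hu : u = v
    · exact Or.inr ⟨w, by simp, hu ▸ hvw.symm⟩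
    by_cases hA : A u
    · by_cases hvu : G.Adj v u
      · rcases hw u hA hvu with h | h
        · exact Or.inl (by simp [h])
        · exact Or.inr ⟨w, by simp, h⟩
      · rcases c.min.1 u with h | ⟨t, ht, h⟩
        · exact Or.inl (by simp [h, hA])
        · have htv : t ≠ v := by rintro rfl; exact hvu h
          exact Or.inr ⟨t, by simp [ht, hsep _ _ h.symm htv hA], h⟩
    · rcases c.dom u hu with h | ⟨t, ht, h⟩
      · exact Or.inl (by simp [h, hA])
      · exact Or.inr ⟨t, by simp [ht, mt (hsep _ _ h hu) hA], h⟩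
  have h1 := dominationNumber_lt_card_of_mem_domCore c.mem_core hS
    (by simp [hvw.ne, hvA, c.not_mem])
  have h2 := Finset.card_insert_le w (D.filter A ∪ D'.filter fun u => ¬ A u)
  have h3 := Finset.card_union_le (D.filter A) (D'.filter fun u => ¬ A u)
  have h4 := Finset.card_filter_add_card_filter_not (s := D') A
  have h5 := c.card_le
  omega

/-- By claws at `v`, `x` dominates the neighbours of `v` on its side, and `y` those on the other.
Comparing `D'` with `D` on both sides, where `v` is on neither, gives `|D'| ≤ |D| - 1`. -/
theorem false_of_separated (c : CoreConfig G v D D' x y) (hclaw : ¬ claw.IsIndContained G)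
    {A : V → Prop} (hvA : ¬ A v) (hx : A x) (hy : ¬ A y)
    (hsep : ∀ s t, G.Adj s t → t ≠ v → A s → A t) : False := by
  classical
  have hvx := c.priv_left.1
  have hvy := c.priv_right.1
  have h1 := c.card_filter_le_of_separated hvA hsep hvx (fun u hu hvu => by
    by_contra! h
    have huy : ¬ G.Adj u y := fun h => hy (hsep _ _ h hvy.ne' hu)
    have hxy : ¬ G.Adj x y := c.not_adj_priv
    refine h.2 (adj_of_claw_free hclaw hvy hvx hvu c.ne.symm ?_ h.1.symm (mt Adj.symm hxy)
      (mt Adj.symm huy))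
    rintro rfl; exact hy hu)
  have h2 := c.card_filter_le_of_separated (A := fun u => ¬ A u ∧ u ≠ v) (by simp)
    (fun s t hst ht hs => ⟨fun h => hs.1 (hsep _ _ hst.symm hs.2 h), ht⟩) hvy
    (fun u hu hvu => by
      by_contra! h
      refine h.2 (adj_of_claw_free hclaw hvx hvy hvu c.ne ?_ h.1.symm c.not_adj_priv
        fun h => hu.1 (hsep _ _ h hu.2 hx))
      rintro rfl; exact hu.1 hx)
  have h3 := Finset.card_filter_add_card_filter_not (s := D') A
  have h4 := Finset.card_filter_add_card_filter_not (s := D) A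
  have h5 : (D.filter fun u => ¬ A u ∧ u ≠ v).card < (D.filter fun u => ¬ A u).card := by
    refine Finset.card_lt_card (Finset.ssubset_iff_of_subset ?_ |>.2 ⟨v, ?_, ?_⟩)
    · intro u
      simp only [Finset.mem_filter]
      tauto
    · simp [c.mem, hvA]
    · simp
  have h6 : (D'.filter fun u => ¬ A u ∧ u ≠ v) = D'.filter fun u => ¬ A u := by
    refine Finset.filter_congr fun u hu => ?_
    have : u ≠ v := fun h => c.not_mem (h ▸ hu)
    tauto
  rw [h6] at h2
  have h7 := c.dominationNumber_le_card
  have h8 := c.min.2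
  omega

/-- In a bull-free graph, an induced path between `x` and `y` avoiding `v` has length at least
four. -/
theorem four_le_of_inducedPath (c : CoreConfig G v D D' x y) (hclaw : ¬ claw.IsIndContained G)
    (hbull : ¬ bull.IsIndContained G) {m : ℕ} {q : ℕ → V} (h0 : q 0 = x) (hm : q m = y)
    (hqv : ∀ i, q i ≠ v) (hq : ∀ i < m, G.Adj (q i) (q (i + 1)))
    (hq' : ∀ i j, i + 1 < j → j ≤ m → ¬ G.Adj (q i) (q j) ∧ q i ≠ q j) : 4 ≤ m := by
  have priv : ∀ u, u ≠ v → (∀ h ∈ D, h ≠ v → ¬ G.Adj h u) → u ∉ D →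
      G.IsPrivateNeighbor D v u := by
    intro u huv hu huD
    refine ⟨?_, fun h hh hv => ⟨fun e => huD (e ▸ hh), hu h hh hv⟩⟩
    rcases c.min.1 u with h | ⟨h, hh, hu'⟩
    · exact absurd h huD
    · by_cases hhv : h = v
      · exact hhv ▸ hu'
      · exact absurd hu' (hu h hh hhv)
  have hxv := c.priv_left
  have hyv := c.priv_right
  have nD : ∀ {t u}, G.IsPrivateNeighbor D v t → G.Adj t u → u ≠ v → u ∉ D :=
    fun ht htu huv hu => (ht.2 _ hu huv).2 htu.symm
  by_contra! hlt
  -- For lengths 2 and 3 the interior vertices are private neighbours, since another dominator would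
  -- give a claw or a bull; then transitivity of adjacency contradicts inducedness.
  interval_cases m
  · exact c.ne (h0.symm.trans hm)
  · have := hq 0 (by omega)
    rw [h0, hm] at this
    exact c.not_adj_priv this
  · have a1 := hq 0 (by omega)
    have a2 := hq 1 (by omega)
    rw [h0] at a1
    norm_num at a1 a2
    rw [hm] at a2
    have hu := priv (q 1) (hqv 1) (fun h hh hhv hadj => by
      obtain ⟨k1, k2⟩ := hxv.2 h hh hhv
      obtain ⟨k3, k4⟩ := hyv.2 h hh hhv
      exact c.not_adj_priv (adj_of_claw_free hclaw hadj.symm a1.symm a2 k1 k3 c.ne k2 k4))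
      (nD hxv a1 (hqv 1))
    exact c.not_adj_priv (c.adj_trans_of_bull_free hclaw hbull hxv hyv hu c.ne a1 a2)
  · have a1 := hq 0 (by omega)
    have a2 := hq 1 (by omega)
    have a3 := hq 2 (by omega)
    have b1 := hq' 0 2 (by omega) (by omega)
    have b2 := hq' 1 3 (by omega) (by omega)
    rw [h0] at a1 b1
    norm_num at a1 a2 a3
    rw [hm] at a3 b2
    have k : ∀ h ∈ D, h ≠ v → G.Adj h (q 1) → G.Adj h (q 2) → False := by
      intro h hh hhv h1 h2
      exact bull_free_elim hbull a2 h2.symm h1.symm a1.symm a3 b2.1 (mt Adj.symm b1.1)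
        (hxv.2 h hh hhv).2 (hyv.2 h hh hhv).2 c.not_adj_priv
    have d1 := nD hxv a1 (hqv 1)
    have d2 := nD hyv a3.symm (hqv 2)
    have p1 := priv (q 1) (hqv 1) (fun h hh hhv hadj => by
      obtain ⟨k1, k2⟩ := hxv.2 h hh hhv
      refine k h hh hhv hadj (adj_of_claw_free hclaw a1.symm hadj.symm a2 k1.symm b1.2 ?_
        (mt Adj.symm k2) b1.1)
      rintro rfl; exact d2 hh) d1
    have p2 := priv (q 2) (hqv 2) (fun h hh hhv hadj => by
      obtain ⟨k1, k2⟩ := hyv.2 h hh hhv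
      refine k h hh hhv (adj_of_claw_free hclaw a3 hadj.symm a2.symm k1.symm b2.2.symm ?_
        (mt Adj.symm k2) (mt Adj.symm b2.1)) hadj
      rintro rfl; exact d1 hh) d2
    exact b1.1 (c.adj_trans_of_bull_free hclaw hbull hxv p2 p1 b1.2 a1 a2)

theorem false_of_bull_free [Finite V] (c : CoreConfig G v D D' x y) (hconn : G.Connected)
    (hclaw : ¬ claw.IsIndContained G) (hbull : ¬ bull.IsIndContained G) : False := by
  have hvx := c.priv_left.1
  have hvy := c.priv_right.1
  have nxy := c.not_adj_priv
  by_cases hreach : (G.deleteVertex v).Reachable ⟨x, hvx.ne'⟩ ⟨y, hvy.ne'⟩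
  swap
  · refine c.false_of_separated hclaw
      (A := fun u => ∃ h : u ≠ v, (G.deleteVertex v).Reachable ⟨x, hvx.ne'⟩ ⟨u, h⟩)
      (fun h => h.1 rfl) ⟨hvx.ne', Reachable.refl _⟩ (fun h => hreach h.2) ?_
    rintro s t hst ht ⟨hs, h⟩
    refine ⟨ht, h.trans (Adj.reachable ?_)⟩
    exact hst
  obtain ⟨m, q', h0', hm', hq₁, hq₂⟩ := hreach.exists_induced_path
  let q : ℕ → V := fun i => (q' i : V)
  have h0 : q 0 = x := congrArg Subtype.val h0'
  have hm : q m = y := congrArg Subtype.val hm'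
  have hqv : ∀ i, q i ≠ v := fun i => (q' i).2
  have hq : ∀ i < m, G.Adj (q i) (q (i + 1)) := hq₁
  have hq' : ∀ i j, i + 1 < j → j ≤ m → ¬ G.Adj (q i) (q j) ∧ q i ≠ q j := fun i j hij hj =>
    ⟨(hq₂ i j hij hj).1, fun h => (hq₂ i j hij hj).2 (Subtype.ext h)⟩
  have hm4 := c.four_le_of_inducedPath hclaw hbull h0 hm hqv hq hq'
  have hmid : ∀ i, 2 ≤ i → i + 2 ≤ m → ¬ G.Adj v (q i) := by
    intro i h2 hi hvi
    have k1 := hq' 0 i (by omega) (by omega)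
    have k2 := hq' i m (by omega) le_rfl
    rw [h0] at k1
    rw [hm] at k2
    exact k2.1 (adj_of_claw_free hclaw hvx hvi hvy k1.2 c.ne k2.2 k1.1 nxy)
  -- Next to an end, say at `q 1`, the triangle `v, q 1, x` with pendants `y`, `q 2` would be a
  -- bull.
  have hv : ∀ i, 0 < i → i < m → ¬ G.Adj v (q i) := by
    intro i hi him hvi
    by_cases h1 : i = 1
    · subst h1
      have a1 := hq 0 (by omega)
      have a2 := hq 1 (by omega)
      have b1 := hq' 0 2 (by omega) (by omega)
      have b2 := hq' 1 m (by omega) le_rfl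
      have b3 := hq' 2 m (by omega) le_rfl
      rw [h0] at a1 b1
      rw [hm] at b2 b3
      exact bull_free_elim hbull hvi a1.symm hvx hvy a2 (hmid 2 le_rfl (by omega)) b2.1 nxy b1.1
        (mt Adj.symm b3.1)
    by_cases h2 : i + 1 = m
    · obtain ⟨k, rfl⟩ : ∃ k, i = k + 1 := ⟨i - 1, by omega⟩
      have a1 := hq (k + 1) (by omega)
      have a2 := hq k (by omega)
      have b1 := hq' k m (by omega) le_rfl
      have b2 := hq' 0 (k + 1) (by omega) (by omega)
      have b3 := hq' 0 k (by omega) (by omega)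
      rw [h2, hm] at a1
      rw [hm] at b1
      rw [h0] at b2 b3
      exact bull_free_elim hbull hvi a1 hvy hvx a2.symm (hmid k (by omega) (by omega))
        (mt Adj.symm b2.1) (mt Adj.symm nxy) (mt Adj.symm b1.1) b3.1
    · exact hmid i (by omega) (by omega) hvi
  obtain ⟨p, hp⟩ := exists_inducedCycle_of_inducedPath (v := v) (by omega) hq
    (fun i j hij hj => (hq' i j hij hj).1) (h0 ▸ hvx) (hm ▸ hvy) hv
  exact notMem_domCore_of_inducedCycle hconn hclaw hbull rfl (by omega) hp v c.mem_core

end CoreConfig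

/-! ### The example for (ii) -/

/-- A hexagon `0, …, 5` with two further vertices: `6`, adjacent to `3, 4, 7`, and `7`, adjacent to
`2, 3, 6`. -/
def hexagonWithEar : SimpleGraph (Fin 8) :=
  fromEdgeSet {s(0, 1), s(1, 2), s(2, 3), s(3, 4), s(4, 5), s(0, 5), s(3, 6), s(4, 6), s(6, 7),
    s(2, 7), s(3, 7)}

instance : DecidableRel hexagonWithEar.Adj := fun a b =>
  decidable_of_iff (s(a, b) ∈ ([s(0, 1), s(1, 2), s(2, 3), s(3, 4), s(4, 5), s(0, 5), s(3, 6),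
    s(4, 6), s(6, 7), s(2, 7), s(3, 7)] : List (Sym2 (Fin 8))) ∧ a ≠ b) (by
      simp [hexagonWithEar, fromEdgeSet_adj])

theorem hexagonWithEar_connected : hexagonWithEar.Connected := by
  have h : ∀ v, hexagonWithEar.Reachable 0 v := by
    have h1 : hexagonWithEar.Reachable 0 1 := Adj.reachable (by decide)
    have h2 : hexagonWithEar.Reachable 0 2 := h1.trans (Adj.reachable (by decide))
    have h3 : hexagonWithEar.Reachable 0 3 := h2.trans (Adj.reachable (by decide))
    have h4 : hexagonWithEar.Reachable 0 4 := h3.trans (Adj.reachable (by decide))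
    have h5 : hexagonWithEar.Reachable 0 5 := Adj.reachable (by decide)
    have h6 : hexagonWithEar.Reachable 0 6 := h3.trans (Adj.reachable (by decide))
    have h7 : hexagonWithEar.Reachable 0 7 := h3.trans (Adj.reachable (by decide))
    intro v
    fin_cases v
    exacts [Reachable.refl _, h1, h2, h3, h4, h5, h6, h7]
  exact (connected_iff_exists_forall_reachable _).2 ⟨0, h⟩

theorem hexagonWithEar_claw_free : ¬ claw.IsIndContained hexagonWithEar := by
  rintro ⟨f⟩
  have key : ∀ c x, hexagonWithEar.Adj c x → ∀ y, hexagonWithEar.Adj c y → x ≠ y →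
      ¬ hexagonWithEar.Adj x y → ∀ z, hexagonWithEar.Adj c z → x ≠ z → y ≠ z →
      ¬ hexagonWithEar.Adj x z → hexagonWithEar.Adj y z := by decide
  have h1 : ∀ i, hexagonWithEar.Adj (f (Sum.inl 0)) (f (Sum.inr i)) := fun i =>
    f.map_rel_iff.2 (by simp [claw])
  have h2 : ∀ i j, ¬ hexagonWithEar.Adj (f (Sum.inr i)) (f (Sum.inr j)) := fun i j h =>
    absurd (f.map_rel_iff.1 h) (by simp [claw])
  have h3 : ∀ i j, i ≠ j → f (Sum.inr i) ≠ f (Sum.inr j) := fun i j hij h =>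
    hij (Sum.inr_injective (f.injective h))
  exact h2 1 2 (key _ _ (h1 0) _ (h1 1) (h3 0 1 (by decide)) (h2 0 1) _ (h1 2)
    (h3 0 2 (by decide)) (h3 1 2 (by decide)) (h2 0 2))

theorem bull_isIndContained_hexagonWithEar : bull.IsIndContained hexagonWithEar := by
  by_contra h
  exact bull_free_elim h (a := 2) (b := 3) (c := 7) (p := 1) (q := 4) (by decide) (by decide)
    (by decide) (by decide) (by decide) (by decide) (by decide) (by decide) (by decide) (by decide)

theorem pathGraph_isIndContained_hexagonWithEar :
    (pathGraph 6).IsIndContained hexagonWithEar := by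
  by_contra h
  exact path_free_elim h (a := 7) (b := 2) (c := 1) (d := 0) (e := 5) (f := 4) (by decide)
    (by decide) (by decide) (by decide) (by decide) (by decide) (by decide) (by decide)
    (by decide) (by decide) (by decide) (by decide) (by decide) (by decide) (by decide)

/-- Vertex `0` need not be dominated, so the bound serves both the graph and its deletion of `0`.
Each vertex misses some vertex other than `0`. -/
theorem hexagonWithEar_two_le {S : Finset (Fin 8)}
    (hS : ∀ v, v ≠ 0 → v ∈ S ∨ ∃ u ∈ S, hexagonWithEar.Adj u v) : 2 ≤ S.card := by
  by_contra! h
  obtain ⟨a, ha⟩ := Finset.card_le_one_iff_subset_singleton.1 (Nat.lt_succ_iff.1 h)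
  have key : ∀ a : Fin 8, ∃ v, v ≠ 0 ∧ v ≠ a ∧ ¬ hexagonWithEar.Adj a v := by decide
  obtain ⟨v, h0, hva, hadj⟩ := key a
  rcases hS v h0 with h | ⟨u, hu, h⟩
  · exact hva (Finset.mem_singleton.1 (ha h))
  · exact hadj (Finset.mem_singleton.1 (ha hu) ▸ h)

theorem dominationNumber_hexagonWithEar : hexagonWithEar.dominationNumber = 2 := by
  refine le_antisymm ?_ ?_
  · have : hexagonWithEar.IsDominatingSet {0, 3} := by
      unfold IsDominatingSet
      decide
    exact this.dominationNumber_le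
  · obtain ⟨S, hS, hc⟩ := exists_isMinDominatingSet hexagonWithEar
    exact hc ▸ hexagonWithEar_two_le fun v _ => hS v

theorem zero_mem_domCore_hexagonWithEar : (0 : Fin 8) ∈ hexagonWithEar.domCore := by
  rintro S ⟨hS, hc⟩
  rw [dominationNumber_hexagonWithEar] at hc
  obtain ⟨a, b, -, rfl⟩ := Finset.card_eq_two.1 hc
  have key : ∀ a b : Fin 8, a ≠ 0 → b ≠ 0 → ∃ v, v ≠ a ∧ v ≠ b ∧
      ¬ hexagonWithEar.Adj a v ∧ ¬ hexagonWithEar.Adj b v := by decide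
  by_contra h
  simp only [Finset.mem_insert, Finset.mem_singleton, not_or] at h
  obtain ⟨v, hva, hvb, ha, hb⟩ := key a b (Ne.symm h.1) (Ne.symm h.2)
  have := hS v
  simp_all

theorem zero_mem_vZero_hexagonWithEar : (0 : Fin 8) ∈ hexagonWithEar.vZero := by
  change (hexagonWithEar.deleteVertex 0).dominationNumber = hexagonWithEar.dominationNumber
  rw [dominationNumber_hexagonWithEar]
  refine le_antisymm ?_ ?_
  -- The pair `2, 4` dominates everything except `0`.
  · have key : ∀ v : Fin 8, v ≠ 0 → (v = 2 ∨ v = 4) ∨ hexagonWithEar.Adj 2 v ∨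
        hexagonWithEar.Adj 4 v := by decide
    have : (hexagonWithEar.deleteVertex 0).IsDominatingSet {⟨2, by simp⟩, ⟨4, by simp⟩} := by
      rintro ⟨v, hv⟩
      rcases key v hv with (rfl | rfl) | h | h
      · simp
      · simp
      · exact Or.inr ⟨⟨2, by simp⟩, by simp, h⟩
      · exact Or.inr ⟨⟨4, by simp⟩, by simp, h⟩
    exact this.dominationNumber_le.trans Finset.card_le_two
  · obtain ⟨S, hS, hc⟩ := exists_isMinDominatingSet (hexagonWithEar.deleteVertex 0)
    rw [← hc, ← Finset.card_map (Function.Embedding.subtype _)]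
    refine hexagonWithEar_two_le fun v hv => ?_
    rcases hS ⟨v, hv⟩ with h | ⟨u, hu, h⟩
    · exact Or.inl (Finset.mem_map_of_mem (Function.Embedding.subtype _) h)
    · exact Or.inr ⟨u, Finset.mem_map_of_mem (Function.Embedding.subtype _) hu, h⟩

theorem mem_vPlus_of_mem_domCore {V : Type*} [Finite V] [Nontrivial V] {G : SimpleGraph V}
    (hconn : G.Connected) (hclaw : ¬ claw.IsIndContained G)
    (hG : ¬ (pathGraph 6).IsIndContained G ∨ ¬ bull.IsIndContained G) {v : V}
    (hv : v ∈ G.domCore) : v ∈ G.vPlus := by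
  by_contra hv'
  obtain ⟨w, hw⟩ := hconn.preconnected.exists_adj_of_nontrivial v
  obtain ⟨D, D', x, y, c⟩ := exists_coreConfig hclaw hw hv hv'
  rcases hG with h | h
  · exact c.false_of_path_free hclaw h
  · exact c.false_of_bull_free hconn hclaw h

end SimpleGraph

open SimpleGraph in
theorem mainTheorem7 :
    (∀ (W : Type*) (H : SimpleGraph W),
      (H.IsIndContained (pathGraph 6) ∨ H.IsIndContained bull) →
      ∀ (V : Type*) [Finite V] [Nontrivial V] (G : SimpleGraph V),
        G.Connected → ¬ H.IsIndContained G → ¬ claw.IsIndContained G →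
        ∀ v, v ∈ G.domCore → v ∈ G.vPlus) ∧
    (∃ (n : ℕ) (G : SimpleGraph (Fin n)),
      G.Connected ∧ ¬ claw.IsIndContained G ∧
      bull.IsIndContained G ∧ (pathGraph 6).IsIndContained G ∧
      ∃ v, v ∈ G.domCore ∩ G.vZero) := by
  refine ⟨fun W H hH V _ _ G hconn hHG hclaw v hv => ?_, 8, hexagonWithEar,
    hexagonWithEar_connected, hexagonWithEar_claw_free, bull_isIndContained_hexagonWithEar,
    pathGraph_isIndContained_hexagonWithEar, 0, zero_mem_domCore_hexagonWithEar,
    zero_mem_vZero_hexagonWithEar⟩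
  exact mem_vPlus_of_mem_domCore hconn hclaw
    (hH.imp (fun h h' => hHG (h.trans h')) (fun h h' => hHG (h.trans h'))) hv
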